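/- Let $p\ge 1$, $n,s\ge 0$ be integers, $T>0$, and let $D\in\mathbb R^{p\times p}$ be an orthonormal matrix whose first column is $p^{-1/2}\mathbf 1$; let $\bar D$ denote $D$ without its first column. Write $\|v\|_0$ for the number of nonzero entries of $v$, and put $$\mathcal F_{p,s,D}=\{f\in\mathbb R_{+}^p:\ \|f\|_1=1,\ \|\bar D^\top f\|_0\le s\}.$$ One observes $y=(y_1,\dots,y_n)$ with independent coordinates $y_i\sim\mathrm{Poisson}(T(Af^*)_i)$, where $f^*\in\mathcal F_{p,s,D}$ is unknown and the sensing matrix $A\in\mathbb R^{n\times p}$, as well as $D$, $s$ and $T$, are known. The minimax risk is $$\mathfrak M=\inf_{\hat f}\ \sup_{f^*\in\mathcal F_{p,s,D}}\ \mathbb E\,\|\hat f(y)-f^*\|_2^2,$$ the infimum being over all measurable estimators $\hat f:\mathbb N^n\to\mathbb R^p$. Let $a_\ell<a_u$ be real numbers and $0\le\delta_s<1$, and assume that there is a matrix $\tilde A\in[a_\ell/\sqrt n,\,a_u/\sqrt n]^{n\times p}$ such that $$A=\frac{\tilde A+\frac{a_u-2a_\ell}{\sqrt n}\,\mathbf 1_{n\times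 p}}{2(a_u-a_\ell)\sqrt n}$$ and $$(1-\delta_s)\|u\|_2^2\le\|\tilde A D u\|_2^2\le(1+\delta_s)\|u\|_2^2\qquad\text{for all }u\in\mathbb R^p\text{ with }\|u\|_0\le 2s.$$ Then there is a constant $C_U>0$ depending only on $a_u$ and $a_\ell$ such that $$\mathfrak M\le C_U\min\left(\frac{s\log_2p}{(1-\delta_s)T}+\frac{s\log_2(T+1)}{(1-\delta_s)T},\ s\max_{j,k}|D_{j,k}|^2,\ 1\right).$$ Moreover, for every $c>0$ there is a constant $C_U'>0$ depending only on $a_u$, $a_\ell$ and $c$ such that, whenever $\log_2(T+1)\le c\log_2p$, $$\mathfrak M\le C_U'\min\left(\frac{s\log_2p}{(1-\delta_s)T},\ s\max_{j,k}|D_{j,k}|^2,\ 1\right).$$ -/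

import Mathlib

open MeasureTheory ProbabilityTheory
open scoped ENNReal NNReal

noncomputable section

namespace PoissonInverse

/-- The number of nonzero entries of a vector. -/
def l0norm {ι : Type*} [Fintype ι] (v : ι → ℝ) : ℕ :=
  Set.ncard {j | v j ≠ 0}

/-- The squared Euclidean norm of a vector. -/
def sqNorm {ι : Type*} [Fintype ι] (v : ι → ℝ) : ℝ :=
  ∑ j, v j ^ 2

/-- `D` is an orthonormal basis matrix whose first column is the constant vector `p^{-1/2}`. -/
structure IsBasisMatrix {p : ℕ} [NeZero p] (D : Matrix (Fin p) (Fin p) ℝ) : Prop where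
  orthonormal : D ∈ Matrix.orthogonalGroup (Fin p) ℝ
  first_col : ∀ i, D i 0 = 1 / √(p : ℝ)

/-- The matrix of all columns of `D` except the first. -/
def tailColumns {p : ℕ} [NeZero p] (D : Matrix (Fin p) (Fin p) ℝ) :
    Matrix (Fin p) {k : Fin p // k ≠ 0} ℝ :=
  D.submatrix id Subtype.val

/-- Nonnegative signals of unit `ℓ1` norm, with at most `s` nonzero non-constant coefficients. -/
def signalClass {p : ℕ} [NeZero p] (s : ℕ) (D : Matrix (Fin p) (Fin p) ℝ) :
    Set (Fin p → ℝ) :=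
  {f | (∀ i, 0 ≤ f i) ∧ ∑ i, |f i| = 1 ∧ l0norm ((tailColumns D).transpose.mulVec f) ≤ s}

/-- The entries of `At` lie in `[a_l / √n, a_u / √n]`, and `A` is the shifted and rescaled
version of `At`, with entries in `[1 / (2 n), 1 / n]`. -/
structure IsShiftedRescaled {n p : ℕ} (a_l a_u : ℝ) (A At : Matrix (Fin n) (Fin p) ℝ) :
    Prop where
  entry_mem : ∀ i j, At i j ∈ Set.Icc (a_l / √(n : ℝ)) (a_u / √(n : ℝ))
  construct : ∀ i j, A i j =
    (At i j + (a_u - 2 * a_l) / √(n : ℝ)) / (2 * (a_u - a_l) * √(n : ℝ))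

/-- Upper restricted isometry condition of order `2 s` for `X`. -/
def UpperRIP {n p : ℕ} (s : ℕ) (δ : ℝ) (X : Matrix (Fin n) (Fin p) ℝ) : Prop :=
  ∀ u : Fin p → ℝ, l0norm u ≤ 2 * s → sqNorm (X.mulVec u) ≤ (1 + δ) * sqNorm u

/-- Lower restricted isometry condition of order `2 s` for `X`. -/
def LowerRIP {n p : ℕ} (s : ℕ) (δ : ℝ) (X : Matrix (Fin n) (Fin p) ℝ) : Prop :=
  ∀ u : Fin p → ℝ, l0norm u ≤ 2 * s → (1 - δ) * sqNorm u ≤ sqNorm (X.mulVec u)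

/-- The law of `y` with independent entries `y i ∼ Poisson (T (A f) i)`. The truncation `toNNReal`
is inactive when `0 ≤ T` and `A`, `f` have nonnegative entries. -/
def observationLaw {n p : ℕ} (T : ℝ) (A : Matrix (Fin n) (Fin p) ℝ) (f : Fin p → ℝ) :
    Measure (Fin n → ℕ) :=
  Measure.pi fun i => poissonMeasure (T * A.mulVec f i).toNNReal

/-- The mean squared error of the estimator `fhat` at the signal `f`. -/
def risk {n p : ℕ} (T : ℝ) (A : Matrix (Fin n) (Fin p) ℝ) (fhat : (Fin n → ℕ) → Fin p → ℝ)
    (f : Fin p → ℝ) : ℝ≥0∞ :=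
  ∫⁻ y, ENNReal.ofReal (sqNorm (fhat y - f)) ∂(observationLaw T A f)

/-- The minimax risk over the signal class: the infimum over measurable estimators of the
worst-case mean squared error. The design (`T`, `A`, `D`, `s`) is known to the estimator. -/
def minimaxRisk {n p : ℕ} [NeZero p] (s : ℕ) (T : ℝ) (A : Matrix (Fin n) (Fin p) ℝ)
    (D : Matrix (Fin p) (Fin p) ℝ) : ℝ≥0∞ :=
  ⨅ (fhat : (Fin n → ℕ) → Fin p → ℝ) (_ : Measurable fhat),
    ⨆ f ∈ signalClass s D, risk T A fhat f

/-- The largest squared entry of `D`. -/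
def maxSqEntry {p : ℕ} (D : Matrix (Fin p) (Fin p) ℝ) : ℝ :=
  ⨆ jk : Fin p × Fin p, |D jk.1 jk.2| ^ 2

end PoissonInverse

end

/-! The estimator behind the rate is maximum likelihood over a finite net: quantize the coefficients
on `s` frequencies with mesh `1 / √T` and keep one signal per nonempty cell. The oracle inequality
`lintegral_hellingerSq_le` bounds the expected Hellinger loss by the log-cardinality of the net plus
the χ² distance from the truth to any chosen member. Intensities lie between `T / (2n)` and `T / n`,
so Hellinger and χ² are both comparable to `T * sqNorm (At *ᵥ (f - g))`, and restricted isometry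
turns this into `T * sqNorm (f - g)`. Cellmates satisfy `T * sqNorm (f - g) ≤ s`, and the
log-cardinality is of order `s (log p + log T)` for `T ≥ 1`. The other two terms of the minimum come
from always answering with the uniform signal (`minimaxRisk_le_min`). -/

namespace PoissonInverse

/-! ### Oracle inequality for Poisson maximum likelihood. -/

section Oracle

lemma hasSum_poisson_pow (r : ℝ≥0) (x : ℝ) :
    HasSum (fun k : ℕ ↦ (Real.exp (-r) * r ^ k / k.factorial) * x ^ k)
      (Real.exp (r * x - r)) := by
  have h := (NormedSpace.expSeries_div_hasSum_exp ((r : ℝ) * x)).mul_left (Real.exp (-r))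
  rw [← Real.exp_eq_exp_ℝ, ← Real.exp_add, neg_add_eq_sub] at h
  convert! h using 2 with k
  rw [mul_pow]
  ring

lemma integrable_pow_poissonMeasure (r : ℝ≥0) {x : ℝ} (hx : 0 ≤ x) :
    Integrable (fun k : ℕ ↦ x ^ k) (poissonMeasure r) := by
  rw [integrable_poissonMeasure_iff]
  refine (hasSum_poisson_pow r x).summable.congr fun k ↦ ?_
  simp [abs_of_nonneg hx]

lemma integral_pow_poissonMeasure (r : ℝ≥0) (x : ℝ) :
    ∫ k : ℕ, x ^ k ∂(poissonMeasure r) = Real.exp (r * x - r) := by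
  rw [integral_poissonMeasure]
  exact (hasSum_poisson_pow r x).tsum_eq

lemma hasSum_poisson_id (r : ℝ≥0) :
    HasSum (fun k : ℕ ↦ (Real.exp (-r) * r ^ k / k.factorial) * (k : ℝ)) r := by
  rw [← hasSum_nat_add_iff' 1]
  have h := (hasSum_one_poissonMeasure r).mul_left (r : ℝ)
  simp only [Finset.range_one, Finset.sum_singleton, Nat.cast_zero, mul_zero, sub_zero]
  rw [mul_one] at h
  convert! h using 2 with k
  rw [Nat.factorial_succ]
  have : (k.factorial : ℝ) ≠ 0 := by positivity
  push_cast
  field_simp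
  ring

lemma integrable_id_poissonMeasure (r : ℝ≥0) :
    Integrable (fun k : ℕ ↦ (k : ℝ)) (poissonMeasure r) := by
  rw [integrable_poissonMeasure_iff]
  refine (hasSum_poisson_id r).summable.congr fun k ↦ ?_
  simp

lemma integral_id_poissonMeasure (r : ℝ≥0) :
    ∫ k : ℕ, (k : ℝ) ∂(poissonMeasure r) = r := by
  rw [integral_poissonMeasure]
  exact (hasSum_poisson_id r).tsum_eq

variable {ι : Type*} [Fintype ι]

/-- The law of independent Poisson counts with intensities `l`. -/
noncomputable def poissonProduct (l : ι → ℝ) : Measure (ι → ℕ) :=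
  Measure.pi fun i ↦ poissonMeasure (l i).toNNReal

instance (l : ι → ℝ) : IsProbabilityMeasure (poissonProduct l) := by
  unfold poissonProduct
  infer_instance

lemma integrable_eval_poissonProduct (l : ι → ℝ) (i : ι) :
    Integrable (fun y : ι → ℕ ↦ (y i : ℝ)) (poissonProduct l) :=
  (measurePreserving_eval (fun i ↦ poissonMeasure (l i).toNNReal) i).integrable_comp_of_integrable
    (integrable_id_poissonMeasure _)

lemma integral_eval_poissonProduct {l : ι → ℝ} (hl : ∀ i, 0 < l i) (i : ι) :
    ∫ y, (y i : ℝ) ∂(poissonProduct l) = l i := by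
  have h := measurePreserving_eval (fun i ↦ poissonMeasure (l i).toNNReal) i
  have h2 := integral_map (μ := poissonProduct l) (φ := Function.eval i)
    (f := fun k : ℕ ↦ (k : ℝ)) (measurable_pi_apply i).aemeasurable
    (Measurable.of_discrete).aestronglyMeasurable
  unfold poissonProduct at h2 ⊢
  rw [h.map_eq, integral_id_poissonMeasure, Real.coe_toNNReal _ (hl i).le] at h2
  exact h2.symm

/-- The Poisson log-likelihood, without the factorial terms. -/
noncomputable def logLik (m : ι → ℝ) (y : ι → ℕ) : ℝ :=
  ∑ i, (y i * Real.log (m i) - m i)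

/-- The squared Hellinger-type distance between intensities. -/
noncomputable def hellingerSq (m l : ι → ℝ) : ℝ :=
  ∑ i, (√(m i) - √(l i)) ^ 2

/-- The square root of the likelihood ratio, divided by the Hellinger affinity. -/
noncomputable def tiltedRatio (l m : ι → ℝ) (y : ι → ℕ) : ℝ :=
  Real.exp (1 / 2 * hellingerSq m l + 1 / 2 * (logLik m y - logLik l y))

/-- The deterministic exponents combine as `(√m - √l)² / 2 - (m - l) / 2 = l - √m √l`, so
independence reduces the mean to one coordinate. -/
lemma tiltedRatio_eq_prod {l m : ι → ℝ} (hl : ∀ i, 0 < l i) (hm : ∀ i, 0 < m i) (y : ι → ℕ) :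
    tiltedRatio l m y =
      ∏ i, (Real.exp (l i - √(m i) * √(l i)) * (√(m i) / √(l i)) ^ (y i)) := by
  rw [tiltedRatio, hellingerSq, logLik, logLik, ← Finset.sum_sub_distrib, Finset.mul_sum,
    Finset.mul_sum, ← Finset.sum_add_distrib, Real.exp_sum]
  refine Finset.prod_congr rfl fun i _ ↦ ?_
  have h1 : √(m i) / √(l i) = Real.exp (1 / 2 * (Real.log (m i) - Real.log (l i))) := by
    rw [mul_sub, Real.exp_sub, Real.sqrt_eq_rpow, Real.sqrt_eq_rpow,
      Real.rpow_def_of_pos (hm i), Real.rpow_def_of_pos (hl i), mul_comm, mul_comm (Real.log (l i))]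
  rw [h1, ← Real.exp_nat_mul, ← Real.exp_add]
  congr 1
  rw [sub_sq, Real.sq_sqrt (hm i).le, Real.sq_sqrt (hl i).le]
  ring

lemma integrable_tiltedRatio {l m : ι → ℝ} (hl : ∀ i, 0 < l i) (hm : ∀ i, 0 < m i) :
    Integrable (tiltedRatio l m) (poissonProduct l) := by
  rw [funext (tiltedRatio_eq_prod hl hm)]
  exact Integrable.fintype_prod
    (f := fun i (k : ℕ) ↦ Real.exp (l i - √(m i) * √(l i)) * (√(m i) / √(l i)) ^ k)
    fun i ↦ (integrable_pow_poissonMeasure _ (by positivity)).const_mul _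

/-- The Poisson generating function at `√m / √l` equals `exp (√m √l - l)`, which cancels the
prefactor in each coordinate. -/
lemma integral_tiltedRatio {l m : ι → ℝ} (hl : ∀ i, 0 < l i) (hm : ∀ i, 0 < m i) :
    ∫ y, tiltedRatio l m y ∂(poissonProduct l) = 1 := by
  simp_rw [tiltedRatio_eq_prod hl hm]
  unfold poissonProduct
  rw [integral_fintype_prod_eq_prod
    (fun i (k : ℕ) ↦ Real.exp (l i - √(m i) * √(l i)) * (√(m i) / √(l i)) ^ k)]
  refine Finset.prod_eq_one fun i _ ↦ ?_
  rw [integral_const_mul, integral_pow_poissonMeasure, Real.coe_toNNReal _ (hl i).le,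
    ← Real.exp_add, Real.exp_eq_one_iff]
  have h : l i * (√(m i) / √(l i)) = √(m i) * √(l i) := by
    have := Real.sqrt_pos.2 (hl i)
    field_simp
    rw [Real.sq_sqrt (hl i).le, mul_comm]
  rw [h]
  ring

/-- From `log x ≤ x - 1` at `x = l / m`. The bound is affine in `y`, and its mean under `l` is
exactly the χ² sum. -/
lemma logLik_sub_le {l m : ι → ℝ} (hl : ∀ i, 0 < l i) (hm : ∀ i, 0 < m i) (y : ι → ℕ) :
    logLik l y - logLik m y ≤ ∑ i, (y i * (l i / m i - 1) + (m i - l i)) := by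
  rw [logLik, logLik, ← Finset.sum_sub_distrib]
  refine Finset.sum_le_sum fun i _ ↦ ?_
  have h := Real.log_le_sub_one_of_pos (div_pos (hl i) (hm i))
  rw [Real.log_div (hl i).ne' (hm i).ne'] at h
  nlinarith [mul_le_mul_of_nonneg_left h (Nat.cast_nonneg (α := ℝ) (y i))]

/-- **Oracle inequality for maximum likelihood over a finite family of Poisson intensities.** -/
theorem lintegral_hellingerSq_le {K : Type*} [Fintype K] {l : ι → ℝ} (hl : ∀ i, 0 < l i)
    {m : K → ι → ℝ} (hm : ∀ k i, 0 < m k i) {khat : (ι → ℕ) → K}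
    (hmax : ∀ y k, logLik (m k) y ≤ logLik (m (khat y)) y) (k₀ : K) :
    ∫⁻ y, ENNReal.ofReal (1 / 2 * hellingerSq (m (khat y)) l) ∂(poissonProduct l) ≤
      ENNReal.ofReal (Real.log (Fintype.card K) + 1 / 2 * ∑ i, (l i - m k₀ i) ^ 2 / m k₀ i) := by
  have : Nonempty K := ⟨k₀⟩
  have hN : (0 : ℝ) < Fintype.card K := by exact_mod_cast Fintype.card_pos
  set N : ℝ := (Fintype.card K : ℝ) with hNdef
  -- An integrable majorant free of `khat`: summing over all candidates removes the dependence on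
  -- the data-driven choice.
  set g : (ι → ℕ) → ℝ := fun y ↦ (Real.log N - 1) + N⁻¹ * ∑ k, tiltedRatio l (m k) y
    + 1 / 2 * ∑ i, (y i * (l i / m k₀ i - 1) + (m k₀ i - l i)) with hg
  have hpt : ∀ y, 1 / 2 * hellingerSq (m (khat y)) l ≤ g y := by
    intro y
    have h1 : tiltedRatio l (m (khat y)) y ≤ ∑ k, tiltedRatio l (m k) y :=
      Finset.single_le_sum (f := fun k ↦ tiltedRatio l (m k) y)
        (fun k _ ↦ (Real.exp_pos _).le) (Finset.mem_univ _)
    -- Linearizing at `log N` yields `log N - 1` plus a term of mean at most one, hence exactly `log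
    -- N` after integration.
    have h2 := Real.add_one_le_exp (1 / 2 * hellingerSq (m (khat y)) l
      + 1 / 2 * (logLik (m (khat y)) y - logLik l y) - Real.log N)
    rw [Real.exp_sub, Real.exp_log hN] at h2
    have h3 : tiltedRatio l (m (khat y)) y / N ≤ N⁻¹ * ∑ k, tiltedRatio l (m k) y := by
      rw [div_eq_inv_mul]
      gcongr
    have h4 := logLik_sub_le hl (hm k₀) y
    have h5 := hmax y k₀
    rw [tiltedRatio] at h3
    simp only [hg]
    linarith
  have hint1 : ∀ i, Integrable (fun y : ι → ℕ ↦ (y i : ℝ) * (l i / m k₀ i - 1) + (m k₀ i - l i))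
      (poissonProduct l) := fun i ↦
    ((integrable_eval_poissonProduct l i).mul_const _).add (integrable_const _)
  have hi1 : Integrable (fun y : ι → ℕ ↦ N⁻¹ * ∑ k, tiltedRatio l (m k) y) (poissonProduct l) :=
    (integrable_finsetSum _ fun k _ ↦ integrable_tiltedRatio hl (hm k)).const_mul _
  have hi2 : Integrable (fun y : ι → ℕ ↦ 1 / 2 *
      ∑ i, ((y i : ℝ) * (l i / m k₀ i - 1) + (m k₀ i - l i))) (poissonProduct l) :=
    (integrable_finsetSum _ fun i _ ↦ hint1 i).const_mul _
  have hi0 : Integrable (fun y : ι → ℕ ↦ (Real.log N - 1) + N⁻¹ * ∑ k, tiltedRatio l (m k) y)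
      (poissonProduct l) := (integrable_const _).add hi1
  have hgint : Integrable g (poissonProduct l) := hi0.add hi2
  have hval : ∫ y, g y ∂(poissonProduct l) =
      Real.log N + 1 / 2 * ∑ i, (l i - m k₀ i) ^ 2 / m k₀ i := by
    simp only [hg]
    rw [integral_add hi0 hi2, integral_add (integrable_const _) hi1, integral_const_mul,
      integral_const_mul, integral_finsetSum _ fun k _ ↦ integrable_tiltedRatio hl (hm k),
      integral_finsetSum _ fun i _ ↦ hint1 i]
    simp_rw [integral_tiltedRatio hl (hm _)]
    have : ∀ i, ∫ y : ι → ℕ, ((y i : ℝ) * (l i / m k₀ i - 1) + (m k₀ i - l i)) ∂(poissonProduct l)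
        = (l i - m k₀ i) ^ 2 / m k₀ i := by
      intro i
      rw [integral_add ((integrable_eval_poissonProduct l i).mul_const _) (integrable_const _),
        integral_mul_const, integral_eval_poissonProduct hl]
      have := (hm k₀ i).ne'
      simp
      field_simp
      ring
    simp_rw [this]
    have : N⁻¹ * N = 1 := inv_mul_cancel₀ hN.ne'
    simp only [probReal_univ, integral_const, smul_eq_mul, one_mul, Finset.sum_const,
      Finset.card_univ, nsmul_eq_mul, mul_one, ← hNdef, this]
    ring
  rw [← hval, ofReal_integral_eq_lintegral_ofReal hgint]
  · exact lintegral_mono fun y ↦ ENNReal.ofReal_le_ofReal (hpt y)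
  · refine Filter.Eventually.of_forall fun y ↦ le_trans ?_ (hpt y)
    exact mul_nonneg (by norm_num) (Finset.sum_nonneg fun i _ ↦ sq_nonneg _)

end Oracle

/-! ### From restricted isometry to Hellinger and χ² comparisons. -/

section Geometry

open Matrix

lemma sqNorm_nonneg {ι : Type*} [Fintype ι] (v : ι → ℝ) : 0 ≤ sqNorm v :=
  Finset.sum_nonneg fun _ _ ↦ sq_nonneg _

lemma sqNorm_eq_dotProduct {ι : Type*} [Fintype ι] (v : ι → ℝ) : sqNorm v = v ⬝ᵥ v := by
  simp [sqNorm, dotProduct, sq]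

variable {n p : ℕ} [NeZero p] {D : Matrix (Fin p) (Fin p) ℝ} {s : ℕ} {f g : Fin p → ℝ}

lemma IsBasisMatrix.mulVec_transpose_mulVec (hD : IsBasisMatrix D) (f : Fin p → ℝ) :
    D *ᵥ (Dᵀ *ᵥ f) = f := by
  have h : D * Dᵀ = 1 := by
    simpa [star_eq_conjTranspose] using (mem_orthogonalGroup_iff (Fin p) ℝ).1 hD.orthonormal
  rw [mulVec_mulVec, h, one_mulVec]

lemma IsBasisMatrix.transpose_mulVec_mulVec (hD : IsBasisMatrix D) (f : Fin p → ℝ) :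
    Dᵀ *ᵥ (D *ᵥ f) = f := by
  have h : Dᵀ * D = 1 := by
    simpa [star_eq_conjTranspose] using (mem_orthogonalGroup_iff' (Fin p) ℝ).1 hD.orthonormal
  rw [mulVec_mulVec, h, one_mulVec]

lemma IsBasisMatrix.sqNorm_transpose_mulVec (hD : IsBasisMatrix D) (f : Fin p → ℝ) :
    sqNorm (Dᵀ *ᵥ f) = sqNorm f := by
  rw [sqNorm_eq_dotProduct, sqNorm_eq_dotProduct, dotProduct_mulVec, vecMul_transpose,
    hD.mulVec_transpose_mulVec]

lemma IsBasisMatrix.transpose_mulVec_zero (hD : IsBasisMatrix D) (f : Fin p → ℝ) :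
    (Dᵀ *ᵥ f) 0 = (∑ i, f i) / √(p : ℝ) := by
  simp only [mulVec, dotProduct, transpose_apply, hD.first_col]
  rw [← Finset.mul_sum]
  ring

lemma sum_eq_one_of_mem_signalClass (hf : f ∈ signalClass s D) : ∑ i, f i = 1 := by
  rw [← hf.2.1]
  exact Finset.sum_congr rfl fun i _ ↦ (abs_of_nonneg (hf.1 i)).symm

/-- The nonconstant frequencies carried by `f`. -/
noncomputable def tailSupport (D : Matrix (Fin p) (Fin p) ℝ) (f : Fin p → ℝ) : Finset (Fin p) :=
  {j | j ≠ 0 ∧ (Dᵀ *ᵥ f) j ≠ 0}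

lemma card_tailSupport_le (hf : f ∈ signalClass s D) : (tailSupport D f).card ≤ s := by
  refine le_trans (le_of_eq ?_) hf.2.2
  rw [l0norm, ← Set.ncard_image_of_injective _ Subtype.val_injective, ← Set.ncard_coe_finset]
  congr 1
  ext j
  simp only [tailSupport, Finset.coe_filter, Finset.mem_univ, true_and, Set.mem_ofPred_eq,
    Set.mem_image, Subtype.exists, exists_and_right, exists_eq_right]
  constructor
  · rintro ⟨h1, h2⟩
    exact ⟨h1, h2⟩
  · rintro ⟨h1, h2⟩
    exact ⟨h1, h2⟩

lemma IsBasisMatrix.transpose_mulVec_sub_zero (hD : IsBasisMatrix D) (hf : f ∈ signalClass s D)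
    (hg : g ∈ signalClass s D) : (Dᵀ *ᵥ (f - g)) 0 = 0 := by
  rw [mulVec_sub, Pi.sub_apply, hD.transpose_mulVec_zero, hD.transpose_mulVec_zero,
    sum_eq_one_of_mem_signalClass hf, sum_eq_one_of_mem_signalClass hg, sub_self]

/-- The constant coefficient cancels because both signals sum to one; this gives `2 * s` rather than
`2 * s + 1`, matching the isometry order. -/
lemma IsBasisMatrix.l0norm_sub_le (hD : IsBasisMatrix D) (hf : f ∈ signalClass s D)
    (hg : g ∈ signalClass s D) : l0norm (Dᵀ *ᵥ (f - g)) ≤ 2 * s := by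
  classical
  have h : {j | (Dᵀ *ᵥ (f - g)) j ≠ 0} ⊆ (↑(tailSupport D f ∪ tailSupport D g) : Set (Fin p)) := by
    intro j hj
    by_contra hcon
    simp only [tailSupport, Finset.coe_union, Finset.coe_filter, Finset.mem_univ, true_and,
      Set.mem_union, Set.mem_ofPred_eq, not_or, not_and, not_not] at hcon
    refine hj ?_
    by_cases hj0 : j = 0
    · rw [hj0]
      exact hD.transpose_mulVec_sub_zero hf hg
    · rw [mulVec_sub, Pi.sub_apply, hcon.1 hj0, hcon.2 hj0, sub_zero]
  calc l0norm (Dᵀ *ᵥ (f - g))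
      ≤ (↑(tailSupport D f ∪ tailSupport D g) : Set (Fin p)).ncard :=
        Set.ncard_le_ncard h (Finset.finite_toSet _)
    _ ≤ (tailSupport D f).card + (tailSupport D g).card := by
        rw [Set.ncard_coe_finset]
        exact Finset.card_union_le _ _
    _ ≤ 2 * s := by
        have := card_tailSupport_le hf
        have := card_tailSupport_le hg
        omega

variable {δ : ℝ} {At : Matrix (Fin n) (Fin p) ℝ}

lemma LowerRIP.sub_le (h : LowerRIP s δ (At * D)) (hD : IsBasisMatrix D)
    (hf : f ∈ signalClass s D) (hg : g ∈ signalClass s D) :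
    (1 - δ) * sqNorm (f - g) ≤ sqNorm (At *ᵥ (f - g)) := by
  have := h _ (hD.l0norm_sub_le hf hg)
  rwa [hD.sqNorm_transpose_mulVec, ← mulVec_mulVec, hD.mulVec_transpose_mulVec] at this

lemma UpperRIP.le_sub (h : UpperRIP s δ (At * D)) (hD : IsBasisMatrix D)
    (hf : f ∈ signalClass s D) (hg : g ∈ signalClass s D) :
    sqNorm (At *ᵥ (f - g)) ≤ (1 + δ) * sqNorm (f - g) := by
  have := h _ (hD.l0norm_sub_le hf hg)
  rwa [hD.sqNorm_transpose_mulVec, ← mulVec_mulVec, hD.mulVec_transpose_mulVec] at this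

variable {a_l a_u T : ℝ} {A : Matrix (Fin n) (Fin p) ℝ}

omit [NeZero p] in
lemma IsShiftedRescaled.entry_bounds (h : IsShiftedRescaled a_l a_u A At) (ha : a_l < a_u)
    (i : Fin n) (j : Fin p) : 1 / (2 * (n : ℝ)) ≤ A i j ∧ A i j ≤ 1 / n := by
  have hn : (0 : ℝ) < n := by exact_mod_cast i.pos
  have hs := Real.sqrt_pos.2 hn
  have hΔ : 0 < a_u - a_l := sub_pos.2 ha
  obtain ⟨h1, h2⟩ := h.entry_mem i j
  rw [h.construct, le_div_iff₀ (by positivity), div_le_iff₀ (by positivity)]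
  have e : (n : ℝ) = √(n : ℝ) * √(n : ℝ) := (Real.mul_self_sqrt hn.le).symm
  have e1 : 1 / (2 * (n : ℝ)) * (2 * (a_u - a_l) * √(n : ℝ)) = (a_u - a_l) / √(n : ℝ) := by
    nth_rw 1 [e]
    field_simp
  have e2 : 1 / (n : ℝ) * (2 * (a_u - a_l) * √(n : ℝ)) = 2 * (a_u - a_l) / √(n : ℝ) := by
    nth_rw 1 [e]
    field_simp
  rw [e1, e2]
  constructor
  · calc (a_u - a_l) / √(n : ℝ) = a_l / √(n : ℝ) + (a_u - 2 * a_l) / √(n : ℝ) := by ring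
      _ ≤ _ := by gcongr
  · calc At i j + (a_u - 2 * a_l) / √(n : ℝ) ≤ a_u / √(n : ℝ) + (a_u - 2 * a_l) / √(n : ℝ) := by
          gcongr
      _ = _ := by ring

lemma IsShiftedRescaled.mulVec_bounds (h : IsShiftedRescaled a_l a_u A At) (ha : a_l < a_u)
    (hf : f ∈ signalClass s D) (i : Fin n) :
    1 / (2 * (n : ℝ)) ≤ (A *ᵥ f) i ∧ (A *ᵥ f) i ≤ 1 / n := by
  have hs := sum_eq_one_of_mem_signalClass hf
  have e : ∀ c : ℝ, c = ∑ j, c * f j := fun c ↦ by rw [← Finset.mul_sum, hs, mul_one]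
  constructor
  · rw [e (1 / (2 * (n : ℝ)))]
    exact Finset.sum_le_sum fun j _ ↦
      mul_le_mul_of_nonneg_right (h.entry_bounds ha i j).1 (hf.1 j)
  · rw [e (1 / (n : ℝ))]
    change ∑ j, A i j * f j ≤ _
    exact Finset.sum_le_sum fun j _ ↦
      mul_le_mul_of_nonneg_right (h.entry_bounds ha i j).2 (hf.1 j)

/-- The constant shift in `A` annihilates `f - g`, whose entries sum to zero. -/
lemma IsShiftedRescaled.mulVec_sub (h : IsShiftedRescaled a_l a_u A At)
    (hf : f ∈ signalClass s D) (hg : g ∈ signalClass s D) (i : Fin n) :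
    (A *ᵥ f) i - (A *ᵥ g) i = (At *ᵥ (f - g)) i / (2 * (a_u - a_l) * √(n : ℝ)) := by
  rw [← Pi.sub_apply, ← Matrix.mulVec_sub]
  simp only [mulVec, dotProduct, h.construct]
  have hz : ∑ j, (f - g) j = 0 := by
    simp [sum_eq_one_of_mem_signalClass hf, sum_eq_one_of_mem_signalClass hg]
  have : ∀ j, (At i j + (a_u - 2 * a_l) / √(n : ℝ)) / (2 * (a_u - a_l) * √(n : ℝ)) * (f - g) j =
      At i j * (f - g) j / (2 * (a_u - a_l) * √(n : ℝ)) +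
        (a_u - 2 * a_l) / √(n : ℝ) / (2 * (a_u - a_l) * √(n : ℝ)) * (f - g) j := fun j ↦ by ring
  simp_rw [this]
  rw [Finset.sum_add_distrib, ← Finset.mul_sum, hz, mul_zero, add_zero, Finset.sum_div]

/-- The Poisson intensities of the signal `f`. -/
noncomputable def intensity (T : ℝ) (A : Matrix (Fin n) (Fin p) ℝ) (f : Fin p → ℝ) (i : Fin n) : ℝ :=
  T * (A *ᵥ f) i

lemma IsShiftedRescaled.intensity_bounds (h : IsShiftedRescaled a_l a_u A At) (ha : a_l < a_u)
    (hT : 0 < T) (hf : f ∈ signalClass s D) (i : Fin n) :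
    T / (2 * (n : ℝ)) ≤ intensity T A f i ∧ intensity T A f i ≤ T / n := by
  obtain ⟨h1, h2⟩ := h.mulVec_bounds ha hf i
  have e1 : T / (2 * (n : ℝ)) = T * (1 / (2 * (n : ℝ))) := by ring
  have e2 : T / (n : ℝ) = T * (1 / n) := by ring
  rw [e1, e2]
  exact ⟨mul_le_mul_of_nonneg_left h1 hT.le, mul_le_mul_of_nonneg_left h2 hT.le⟩

lemma IsShiftedRescaled.intensity_pos (h : IsShiftedRescaled a_l a_u A At) (ha : a_l < a_u)
    (hT : 0 < T) (hf : f ∈ signalClass s D) (i : Fin n) : 0 < intensity T A f i := by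
  have hn : (0 : ℝ) < n := by exact_mod_cast i.pos
  exact lt_of_lt_of_le (by positivity) (h.intensity_bounds ha hT hf i).1

lemma IsShiftedRescaled.intensity_sub_sq (h : IsShiftedRescaled a_l a_u A At)
    (hf : f ∈ signalClass s D) (hg : g ∈ signalClass s D) (i : Fin n) :
    (intensity T A f i - intensity T A g i) ^ 2 =
      T ^ 2 / (4 * (a_u - a_l) ^ 2 * n) * (At *ᵥ (f - g)) i ^ 2 := by
  have hn : (0 : ℝ) < n := by exact_mod_cast i.pos
  rw [intensity, intensity, ← mul_sub, h.mulVec_sub hf hg, mul_pow, div_pow, mul_pow, mul_pow,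
    Real.sq_sqrt hn.le]
  ring

/-- Factor `(x - y)² = (√x - √y)² (√x + √y)²`; the upper intensity bound gives `(√x + √y)² ≤ 4T /
n`. -/
lemma IsShiftedRescaled.le_hellingerSq (h : IsShiftedRescaled a_l a_u A At) (ha : a_l < a_u)
    (hT : 0 < T) (hf : f ∈ signalClass s D) (hg : g ∈ signalClass s D) :
    T / (16 * (a_u - a_l) ^ 2) * sqNorm (At *ᵥ (f - g)) ≤
      hellingerSq (intensity T A f) (intensity T A g) := by
  have hΔ : 0 < a_u - a_l := sub_pos.2 ha
  rw [sqNorm, hellingerSq, Finset.mul_sum]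
  refine Finset.sum_le_sum fun i _ ↦ ?_
  have hn : (0 : ℝ) < n := by exact_mod_cast i.pos
  have hf0 := h.intensity_pos ha hT hf i
  have hg0 := h.intensity_pos ha hT hg i
  have hf1 := (h.intensity_bounds ha hT hf i).2
  have hg1 := (h.intensity_bounds ha hT hg i).2
  have key := h.intensity_sub_sq (T := T) hf hg i
  set x := intensity T A f i
  set y := intensity T A g i
  have hx := Real.sq_sqrt hf0.le
  have hy := Real.sq_sqrt hg0.le
  have h1 : (√x + √y) ^ 2 ≤ 4 * T / n := by
    have : 4 * T / n = 2 * (T / n) + 2 * (T / n) := by ring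
    rw [this]
    nlinarith [sq_nonneg (√x - √y)]
  have h2 : (x - y) ^ 2 ≤ (√x - √y) ^ 2 * (4 * T / n) := by
    calc (x - y) ^ 2 = (√x - √y) ^ 2 * (√x + √y) ^ 2 := by rw [← hx, ← hy]; ring_nf; simp [hx, hy]
      _ ≤ _ := by gcongr
  rw [key] at h2
  have h3 : T ^ 2 / (4 * (a_u - a_l) ^ 2 * n) * (At *ᵥ (f - g)) i ^ 2 =
      T / (16 * (a_u - a_l) ^ 2) * (At *ᵥ (f - g)) i ^ 2 * (4 * T / n) := by
    field_simp
    ring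
  rw [h3] at h2
  exact le_of_mul_le_mul_right h2 (by positivity)

/-- Here the lower intensity bound `T / (2n)` controls the denominators. -/
lemma IsShiftedRescaled.chiSq_le (h : IsShiftedRescaled a_l a_u A At) (ha : a_l < a_u)
    (hT : 0 < T) (hf : f ∈ signalClass s D) (hg : g ∈ signalClass s D) :
    ∑ i, (intensity T A f i - intensity T A g i) ^ 2 / intensity T A g i ≤
      T / (2 * (a_u - a_l) ^ 2) * sqNorm (At *ᵥ (f - g)) := by
  have hΔ : 0 < a_u - a_l := sub_pos.2 ha
  rw [sqNorm, Finset.mul_sum]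
  refine Finset.sum_le_sum fun i _ ↦ ?_
  have hn : (0 : ℝ) < n := by exact_mod_cast i.pos
  have hg0 := h.intensity_pos ha hT hg i
  have hg1 := (h.intensity_bounds ha hT hg i).1
  rw [h.intensity_sub_sq hf hg, div_le_iff₀ hg0]
  calc T ^ 2 / (4 * (a_u - a_l) ^ 2 * n) * (At *ᵥ (f - g)) i ^ 2
      = T / (2 * (a_u - a_l) ^ 2) * (At *ᵥ (f - g)) i ^ 2 * (T / (2 * n)) := by
        field_simp
        ring
    _ ≤ _ := by gcongr

end Geometry

/-! ### Coefficient bounds, the uniform signal and the quantization net. -/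

section Net

open Matrix

variable {n p : ℕ} [NeZero p] {D : Matrix (Fin p) (Fin p) ℝ} {s : ℕ} {f g : Fin p → ℝ} {T : ℝ}

lemma sqNorm_le_one_of_mem_signalClass (hf : f ∈ signalClass s D) : sqNorm f ≤ 1 := by
  have hs := sum_eq_one_of_mem_signalClass hf
  rw [← hs, sqNorm]
  refine Finset.sum_le_sum fun i _ ↦ ?_
  have h1 : f i ≤ 1 := hs ▸ Finset.single_le_sum (fun j _ ↦ hf.1 j) (Finset.mem_univ i)
  nlinarith [hf.1 i]

lemma IsBasisMatrix.sq_coeff_le_one (hD : IsBasisMatrix D) (hf : f ∈ signalClass s D)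
    (j : Fin p) : (Dᵀ *ᵥ f) j ^ 2 ≤ 1 :=
  calc (Dᵀ *ᵥ f) j ^ 2 ≤ sqNorm (Dᵀ *ᵥ f) :=
        Finset.single_le_sum (f := fun j ↦ (Dᵀ *ᵥ f) j ^ 2) (fun _ _ ↦ sq_nonneg _)
          (Finset.mem_univ j)
    _ = sqNorm f := hD.sqNorm_transpose_mulVec f
    _ ≤ 1 := sqNorm_le_one_of_mem_signalClass hf

/-- Each coefficient is the average of a column of `D` under the probability vector `f`, so Jensen
applies. -/
lemma sq_coeff_le_maxSqEntry (hf : f ∈ signalClass s D) (j : Fin p) :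
    (Dᵀ *ᵥ f) j ^ 2 ≤ maxSqEntry D := by
  have hs := sum_eq_one_of_mem_signalClass hf
  have h := Real.pow_arith_mean_le_arith_mean_pow_of_even Finset.univ f (fun i ↦ D i j)
    (fun i _ ↦ hf.1 i) hs even_two
  have e : (Dᵀ *ᵥ f) j = ∑ i, f i * D i j := by
    simp only [mulVec, dotProduct, transpose_apply, mul_comm]
  rw [e]
  refine h.trans ?_
  calc ∑ i, f i * D i j ^ 2 ≤ ∑ i, f i * maxSqEntry D := by
        refine Finset.sum_le_sum fun i _ ↦ mul_le_mul_of_nonneg_left ?_ (hf.1 i)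
        have := le_ciSup (f := fun jk : Fin p × Fin p ↦ |D jk.1 jk.2| ^ 2)
          (Set.finite_range _).bddAbove (i, j)
        simpa [maxSqEntry] using this
    _ = maxSqEntry D := by rw [← Finset.sum_mul, hs, one_mul]

/-- The uniform signal. -/
noncomputable def uniformSignal (p : ℕ) : Fin p → ℝ := fun _ ↦ 1 / p

lemma IsBasisMatrix.coeff_uniformSignal (hD : IsBasisMatrix D) {j : Fin p} (hj : j ≠ 0) :
    (Dᵀ *ᵥ uniformSignal p) j = 0 := by
  have e : uniformSignal p = D *ᵥ Pi.single 0 (1 / √(p : ℝ)) := by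
    ext i
    have hp : (0 : ℝ) < p := by exact_mod_cast Nat.pos_of_ne_zero (NeZero.ne p)
    have := Real.mul_self_sqrt hp.le
    rw [mulVec_single]
    simp only [uniformSignal, Pi.smul_apply, col_apply, hD.first_col, MulOpposite.smul_eq_mul_unop,
      MulOpposite.unop_op]
    rw [div_mul_div_comm, this, one_mul]
  rw [e, hD.transpose_mulVec_mulVec, Pi.single_eq_of_ne hj]

lemma IsBasisMatrix.uniformSignal_mem (hD : IsBasisMatrix D) :
    uniformSignal p ∈ signalClass s D := by
  have hp : (0 : ℝ) < p := by exact_mod_cast Nat.pos_of_ne_zero (NeZero.ne p)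
  refine ⟨fun i ↦ ?_, ?_, ?_⟩
  · simp only [uniformSignal]
    positivity
  · simp [uniformSignal, hp.ne']
  · have : (tailColumns D).transpose.mulVec (uniformSignal p) = 0 := by
      ext j
      exact hD.coeff_uniformSignal j.2
    simp [this, l0norm]

lemma IsBasisMatrix.sqNorm_uniformSignal_sub (hD : IsBasisMatrix D) (hf : f ∈ signalClass s D) :
    sqNorm (uniformSignal p - f) = ∑ j ∈ tailSupport D f, (Dᵀ *ᵥ f) j ^ 2 := by
  rw [← hD.sqNorm_transpose_mulVec, sqNorm]
  have h : ∀ j ∈ tailSupport D f, (Dᵀ *ᵥ f) j ^ 2 = (Dᵀ *ᵥ (uniformSignal p - f)) j ^ 2 := by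
    intro j hj
    rw [mulVec_sub, Pi.sub_apply, hD.coeff_uniformSignal (Finset.mem_filter.1 hj).2.1]
    ring
  rw [Finset.sum_congr rfl h]
  refine (Finset.sum_subset (Finset.subset_univ _) fun j _ hj ↦ ?_).symm
  by_cases hj0 : j = 0
  · rw [hj0, hD.transpose_mulVec_sub_zero (hD.uniformSignal_mem (s := s)) hf]
    simp
  · simp only [tailSupport, Finset.mem_filter, Finset.mem_univ, true_and, not_and, not_not] at hj
    rw [mulVec_sub, Pi.sub_apply, hD.coeff_uniformSignal hj0, hj hj0]
    simp

/-- The labels of grid cells: `s` frequencies and quantized coefficients. -/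
abbrev CellLabel (p s L : ℕ) : Type :=
  Fin s → Fin p × Finset.Icc (-(L : ℤ)) L

/-- `f` belongs to the grid cell of mesh `1 / √T` with label `k`. -/
def IsInCell (D : Matrix (Fin p) (Fin p) ℝ) (T : ℝ) {L : ℕ} (k : CellLabel p s L)
    (f : Fin p → ℝ) : Prop :=
  f ∈ signalClass s D ∧ (∀ j ∈ tailSupport D f, ∃ i, (k i).1 = j) ∧
    ∀ i, ⌊√T * (Dᵀ *ᵥ f) (k i).1⌋ = (k i).2.1

lemma card_cellLabel (p s L : ℕ) : Fintype.card (CellLabel p s L) = (p * (2 * L + 1)) ^ s := by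
  have : ((L : ℤ) + 1 + (L : ℤ)).toNat = 2 * L + 1 := by omega
  simp [this]

lemma IsBasisMatrix.exists_isInCell (hD : IsBasisMatrix D) (hf : f ∈ signalClass s D) {L : ℕ}
    (hL : √T ≤ L) : ∃ k : CellLabel p s L, IsInCell D T k f := by
  have hfloor : ∀ j, ⌊√T * (Dᵀ *ᵥ f) j⌋ ∈ Finset.Icc (-(L : ℤ)) L := by
    intro j
    have h := abs_le.1 (abs_le_one_iff_mul_self_le_one.2 (by
      simpa [sq] using hD.sq_coeff_le_one hf j))
    have hT := Real.sqrt_nonneg T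
    rw [Finset.mem_Icc, Int.le_floor, ← Int.lt_add_one_iff, Int.floor_lt]
    push_cast
    constructor <;> nlinarith
  have hc := card_tailSupport_le hf
  classical
  -- Surplus slots are filled with frequency `0`, which is harmless since all signals share that
  -- coefficient.
  let φ : Fin s → Fin p := fun i ↦ if h : (i : ℕ) < (tailSupport D f).card then
    ((tailSupport D f).equivFin.symm ⟨i, h⟩ : Fin p) else 0
  refine ⟨fun i ↦ (φ i, ⟨_, hfloor (φ i)⟩), hf, fun j hj ↦ ?_, fun i ↦ rfl⟩
  refine ⟨Fin.castLE hc ((tailSupport D f).equivFin ⟨j, hj⟩), ?_⟩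
  simp [φ]

/-- Cellmates can differ only on the at most `s` labelled frequencies, and equal floors keep each
scaled difference below one. -/
lemma IsInCell.mul_sqNorm_sub_le (hD : IsBasisMatrix D) (hT : 0 ≤ T) {L : ℕ}
    {k : CellLabel p s L} (hf : IsInCell D T k f) (hg : IsInCell D T k g) :
    T * sqNorm (f - g) ≤ s := by
  classical
  rw [← hD.sqNorm_transpose_mulVec, sqNorm, Finset.mul_sum]
  have hsub : ∑ j, T * (Dᵀ *ᵥ (f - g)) j ^ 2 =
      ∑ j ∈ Finset.univ.image fun i ↦ (k i).1, T * (Dᵀ *ᵥ (f - g)) j ^ 2 := by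
    refine (Finset.sum_subset (Finset.subset_univ _) fun j _ hj ↦ ?_).symm
    suffices h : (Dᵀ *ᵥ (f - g)) j = 0 by simp [h]
    by_cases hj0 : j = 0
    · rw [hj0, hD.transpose_mulVec_sub_zero hf.1 hg.1]
    · have hz : ∀ h, IsInCell D T k h → (Dᵀ *ᵥ h) j = 0 := by
        intro h hh
        by_contra hne
        obtain ⟨i, hi⟩ := hh.2.1 j (by simp [tailSupport, hj0, hne])
        exact hj (Finset.mem_image.2 ⟨i, Finset.mem_univ _, hi⟩)
      rw [mulVec_sub, Pi.sub_apply, hz f hf, hz g hg, sub_zero]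
  rw [hsub]
  have hone : ∀ j ∈ Finset.univ.image fun i ↦ (k i).1, T * (Dᵀ *ᵥ (f - g)) j ^ 2 ≤ 1 := by
    intro j hj
    obtain ⟨i, -, rfl⟩ := Finset.mem_image.1 hj
    have h := Int.abs_sub_lt_one_of_floor_eq_floor ((hf.2.2 i).trans (hg.2.2 i).symm)
    rw [← mul_sub] at h
    rw [mulVec_sub, Pi.sub_apply]
    calc T * ((Dᵀ *ᵥ f) (k i).1 - (Dᵀ *ᵥ g) (k i).1) ^ 2
        = (√T * ((Dᵀ *ᵥ f) (k i).1 - (Dᵀ *ᵥ g) (k i).1)) ^ 2 := by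
          rw [mul_pow, Real.sq_sqrt hT]
      _ ≤ 1 := (sq_le_one_iff_abs_le_one _).2 h.le
  refine (Finset.sum_le_card_nsmul _ _ _ hone).trans ?_
  rw [nsmul_eq_mul, mul_one]
  exact_mod_cast Finset.card_image_le.trans (by simp)

end Net

/-! ### Risk bounds and assembly of the rate. -/

section Risk

open Matrix

variable {n p : ℕ} [NeZero p] {D : Matrix (Fin p) (Fin p) ℝ} {s : ℕ} {T δ a_l a_u : ℝ}
  {A At : Matrix (Fin n) (Fin p) ℝ}

lemma minimaxRisk_le {b : ℝ≥0∞} (fhat : (Fin n → ℕ) → Fin p → ℝ)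
    (h : ∀ f ∈ signalClass s D, risk T A fhat f ≤ b) : minimaxRisk s T A D ≤ b :=
  iInf₂_le_of_le fhat .of_discrete (iSup₂_le h)

omit [NeZero p] in
lemma observationLaw_eq (f : Fin p → ℝ) :
    observationLaw T A f = poissonProduct (intensity T A f) := rfl

lemma minimaxRisk_le_of_sqNorm_le {b : ℝ}
    (h : ∀ f ∈ signalClass s D, sqNorm (uniformSignal p - f) ≤ b) :
    minimaxRisk s T A D ≤ ENNReal.ofReal b := by
  refine minimaxRisk_le (fun _ ↦ uniformSignal p) fun f hf ↦ ?_
  rw [risk, observationLaw_eq, lintegral_const, measure_univ, mul_one]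
  exact ENNReal.ofReal_le_ofReal (h f hf)

omit [NeZero p] in
lemma maxSqEntry_nonneg (D : Matrix (Fin p) (Fin p) ℝ) : 0 ≤ maxSqEntry D :=
  Real.iSup_nonneg fun _ ↦ by positivity

lemma IsBasisMatrix.minimaxRisk_le_min (hD : IsBasisMatrix D) :
    minimaxRisk s T A D ≤ ENNReal.ofReal (min (s * maxSqEntry D) 1) := by
  refine minimaxRisk_le_of_sqNorm_le fun f hf ↦ ?_
  rw [hD.sqNorm_uniformSignal_sub hf]
  refine le_min ?_ ?_
  · refine (Finset.sum_le_card_nsmul _ _ _ fun j _ ↦ sq_coeff_le_maxSqEntry hf j).trans ?_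
    rw [nsmul_eq_mul]
    exact mul_le_mul_of_nonneg_right (by exact_mod_cast card_tailSupport_le hf)
      (maxSqEntry_nonneg D)
  · calc ∑ j ∈ tailSupport D f, (Dᵀ *ᵥ f) j ^ 2 ≤ sqNorm (Dᵀ *ᵥ f) :=
          Finset.sum_le_sum_of_subset_of_nonneg (Finset.subset_univ _) fun _ _ _ ↦ sq_nonneg _
      _ ≤ 1 := by
          rw [hD.sqNorm_transpose_mulVec]
          exact sqNorm_le_one_of_mem_signalClass hf

lemma IsBasisMatrix.minimaxRisk_eq_zero_of_eq_one (hD : IsBasisMatrix D) (hp : p = 1) :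
    minimaxRisk s T A D = 0 := by
  rw [← nonpos_iff_eq_zero, ← ENNReal.ofReal_zero]
  refine minimaxRisk_le_of_sqNorm_le fun f hf ↦ ?_
  rw [hD.sqNorm_uniformSignal_sub hf]
  refine (Finset.sum_eq_zero fun j hj ↦ ?_).le
  subst hp
  exact absurd (Subsingleton.elim j 0) (Finset.mem_filter.1 hj).2.1

/-- Maximum likelihood over one representative of each nonempty grid cell. -/
lemma minimaxRisk_le_log_card (ha : a_l < a_u) (hT : 0 < T) (hδ : δ < 1)
    (hD : IsBasisMatrix D) (hA : IsShiftedRescaled a_l a_u A At)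
    (hU : UpperRIP s δ (At * D)) (hL : LowerRIP s δ (At * D)) {L : ℕ} (hTL : √T ≤ L) :
    minimaxRisk s T A D ≤ ENNReal.ofReal
      ((32 * (a_u - a_l) ^ 2 * (s * (Real.log p + Real.log (2 * L + 1))) + 16 * s) /
        ((1 - δ) * T)) := by
  classical
  have hΔ : 0 < a_u - a_l := sub_pos.2 ha
  have hδ' : 0 < 1 - δ := sub_pos.2 hδ
  have hp : (0 : ℝ) < p := by exact_mod_cast Nat.pos_of_ne_zero (NeZero.ne p)
  -- Representatives must lie in the signal class for the isometry bounds to apply, so they are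
  -- taken from the cells rather than from grid points. Empty cells receive the uniform signal as a
  -- default.
  have hrep : ∀ k : CellLabel p s L, ∃ g ∈ signalClass s D,
      (∃ f, IsInCell D T k f) → IsInCell D T k g := by
    intro k
    by_cases h : ∃ f, IsInCell D T k f
    · obtain ⟨f, hf⟩ := h
      exact ⟨f, hf.1, fun _ ↦ hf⟩
    · exact ⟨uniformSignal p, hD.uniformSignal_mem, fun h' ↦ absurd h' h⟩
  choose rep hmem hcell using hrep
  obtain ⟨k₁, -⟩ := hD.exists_isInCell (s := s) (hD.uniformSignal_mem) hTL
  have : Nonempty (CellLabel p s L) := ⟨k₁⟩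
  have hmle : ∀ y : Fin n → ℕ, ∃ khat, ∀ k,
      logLik (intensity T A (rep k)) y ≤ logLik (intensity T A (rep khat)) y := fun y ↦
    Finite.exists_max fun k ↦ logLik (intensity T A (rep k)) y
  choose khat hmax using hmle
  refine minimaxRisk_le (fun y ↦ rep (khat y)) fun f hf ↦ ?_
  obtain ⟨k₀, hk₀⟩ := hD.exists_isInCell hf hTL
  have hk₀' := hcell k₀ ⟨f, hk₀⟩
  have horacle := lintegral_hellingerSq_le (hA.intensity_pos ha hT hf)
    (fun k ↦ hA.intensity_pos ha hT (hmem k)) hmax k₀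
  -- `B` inverts the Hellinger lower bound: `16 (a_u - a_l)² / T`, times `2` for the factor one
  -- half, over `1 - δ`.
  set B : ℝ := 32 * (a_u - a_l) ^ 2 / ((1 - δ) * T) with hB
  have hBpos : 0 < B := by positivity
  have hpt : ∀ y, sqNorm (rep (khat y) - f) ≤
      B * (1 / 2 * hellingerSq (intensity T A (rep (khat y))) (intensity T A f)) := by
    intro y
    have h1 := hA.le_hellingerSq ha hT (hmem (khat y)) hf
    have h2 := hL.sub_le hD (hmem (khat y)) hf
    calc sqNorm (rep (khat y) - f)
        = B * (1 / 2 * (T / (16 * (a_u - a_l) ^ 2) *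
            ((1 - δ) * sqNorm (rep (khat y) - f)))) := by
          rw [hB]
          field_simp
          ring
      _ ≤ _ := by
          refine mul_le_mul_of_nonneg_left (mul_le_mul_of_nonneg_left (le_trans ?_ h1)
            (by norm_num)) hBpos.le
          exact mul_le_mul_of_nonneg_left h2 (by positivity)
  have hcard : Real.log (Fintype.card (CellLabel p s L)) =
      s * (Real.log p + Real.log (2 * L + 1)) := by
    rw [card_cellLabel]
    push_cast
    rw [Real.log_pow, Real.log_mul hp.ne' (by positivity)]
  have hchi : 1 / 2 * ∑ i, (intensity T A f i - intensity T A (rep k₀) i) ^ 2 /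
      intensity T A (rep k₀) i ≤ s / (2 * (a_u - a_l) ^ 2) := by
    have h1 := hA.chiSq_le ha hT hf (hmem k₀)
    have h2 := hU.le_sub hD hf (hmem k₀)
    have h3 := hk₀.mul_sqNorm_sub_le hD hT.le hk₀'
    have h4 : sqNorm (At *ᵥ (f - rep k₀)) ≤ 2 * sqNorm (f - rep k₀) :=
      h2.trans (mul_le_mul_of_nonneg_right (by linarith) (sqNorm_nonneg _))
    calc _ ≤ 1 / 2 * (T / (2 * (a_u - a_l) ^ 2) * (2 * sqNorm (f - rep k₀))) := by
          refine mul_le_mul_of_nonneg_left (h1.trans ?_) (by norm_num)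
          exact mul_le_mul_of_nonneg_left h4 (by positivity)
      _ = (T * sqNorm (f - rep k₀)) / (2 * (a_u - a_l) ^ 2) := by ring
      _ ≤ _ := by gcongr
  calc risk T A (fun y ↦ rep (khat y)) f
      ≤ ∫⁻ y, ENNReal.ofReal B * ENNReal.ofReal
          (1 / 2 * hellingerSq (intensity T A (rep (khat y))) (intensity T A f))
          ∂(poissonProduct (intensity T A f)) := by
        rw [risk, observationLaw_eq]
        refine lintegral_mono fun y ↦ ?_
        rw [← ENNReal.ofReal_mul hBpos.le]
        exact ENNReal.ofReal_le_ofReal (hpt y)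
    _ ≤ ENNReal.ofReal B * ENNReal.ofReal (s * (Real.log p + Real.log (2 * L + 1)) +
          s / (2 * (a_u - a_l) ^ 2)) := by
        rw [lintegral_const_mul _ .of_discrete]
        gcongr
        refine horacle.trans (ENNReal.ofReal_le_ofReal ?_)
        rw [hcard]
        gcongr
    _ = _ := by
        rw [← ENNReal.ofReal_mul hBpos.le]
        congr 1
        rw [hB]
        field_simp
        ring

lemma log_le_logb_two {x : ℝ} (hx : 1 ≤ x) : Real.log x ≤ Real.logb 2 x := by
  rw [Real.logb, le_div_iff₀ (Real.log_pos one_lt_two)]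
  exact mul_le_of_le_one_right (Real.log_nonneg hx) (by linarith [Real.log_two_lt_d9])

/-- For `T ≥ 1`, `2⌈√T⌉ + 1 ≤ 2T + 3 ≤ (T + 1)³`. -/
lemma log_two_mul_ceil_sqrt_le (hT : 1 ≤ T) :
    Real.log (2 * (⌈√T⌉₊ : ℝ) + 1) ≤ 3 * Real.log (T + 1) := by
  have h1 := (Nat.ceil_lt_add_one (Real.sqrt_nonneg T)).le
  have h2 : √T ≤ T := Real.sqrt_le_iff.2 ⟨by linarith, by nlinarith⟩
  have h3 : (3 : ℝ) * Real.log (T + 1) = Real.log ((T + 1) ^ 3) := by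
    rw [Real.log_pow]
    norm_num
  rw [h3]
  refine Real.log_le_log (by positivity) ?_
  nlinarith [mul_nonneg (by linarith : 0 ≤ T) (sub_nonneg.2 hT), pow_pos (by linarith : 0 < T) 3]

lemma minimaxRisk_le_of_one_le (ha : a_l < a_u) (hT : 1 ≤ T) (hδ : δ < 1)
    (hD : IsBasisMatrix D) (hA : IsShiftedRescaled a_l a_u A At)
    (hU : UpperRIP s δ (At * D)) (hL : LowerRIP s δ (At * D)) :
    minimaxRisk s T A D ≤ ENNReal.ofReal ((96 * (a_u - a_l) ^ 2 + 16) *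
      (s * Real.logb 2 p / ((1 - δ) * T) + s * Real.logb 2 (T + 1) / ((1 - δ) * T))) := by
  have hT0 : 0 < T := by linarith
  have hδ' : 0 < 1 - δ := sub_pos.2 hδ
  have hp : (1 : ℝ) ≤ p := by exact_mod_cast Nat.pos_of_ne_zero (NeZero.ne p)
  refine (minimaxRisk_le_log_card ha hT0 hδ hD hA hU hL (Nat.le_ceil _)).trans
    (ENNReal.ofReal_le_ofReal ?_)
  rw [← add_div, ← mul_div_assoc]
  gcongr
  have h1 := log_le_logb_two hp
  have h2 : Real.log (T + 1) ≤ Real.logb 2 (T + 1) := log_le_logb_two (by linarith)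
  have h3 := log_two_mul_ceil_sqrt_le hT
  -- This absorbs the χ² remainder `16 * s` into the logarithmic term.
  have h4 : 1 ≤ Real.logb 2 (T + 1) := by
    rw [Real.le_logb_iff_rpow_le one_lt_two (by linarith)]
    norm_num
    linarith
  have h5 : 0 ≤ Real.logb 2 p := Real.logb_nonneg one_lt_two hp
  have h6 : (0 : ℝ) ≤ s := s.cast_nonneg
  have h7 : 0 ≤ (a_u - a_l) ^ 2 := sq_nonneg _
  calc 32 * (a_u - a_l) ^ 2 * (s * (Real.log p + Real.log (2 * ⌈√T⌉₊ + 1))) + 16 * s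
      ≤ 32 * (a_u - a_l) ^ 2 * (s * (3 * Real.logb 2 p + 3 * Real.logb 2 (T + 1))) +
        16 * (s * (Real.logb 2 p + Real.logb 2 (T + 1))) := by
        gcongr
        · linarith
        · linarith
        · exact le_mul_of_one_le_right h6 (by linarith)
    _ = _ := by ring

lemma minimaxRisk_le_rate (ha : a_l < a_u) (hT : 0 < T) (hδ0 : 0 ≤ δ) (hδ : δ < 1)
    (hD : IsBasisMatrix D) (hA : IsShiftedRescaled a_l a_u A At)
    (hU : UpperRIP s δ (At * D)) (hL : LowerRIP s δ (At * D)) :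
    minimaxRisk s T A D ≤ ENNReal.ofReal ((96 * (a_u - a_l) ^ 2 + 16) *
      min (s * Real.logb 2 p / ((1 - δ) * T) + s * Real.logb 2 (T + 1) / ((1 - δ) * T))
        (min (s * maxSqEntry D) 1)) := by
  have hδ' : 0 < 1 - δ := sub_pos.2 hδ
  have hC : 1 ≤ 96 * (a_u - a_l) ^ 2 + 16 := by nlinarith [sq_nonneg (a_u - a_l)]
  have hp : (1 : ℝ) ≤ p := by exact_mod_cast Nat.pos_of_ne_zero (NeZero.ne p)
  have hm : 0 ≤ min (s * maxSqEntry D) 1 :=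
    le_min (mul_nonneg s.cast_nonneg (maxSqEntry_nonneg D)) zero_le_one
  have htriv : minimaxRisk s T A D ≤ ENNReal.ofReal (min (s * maxSqEntry D) 1) :=
    hD.minimaxRisk_le_min
  have h5 : 0 ≤ Real.logb 2 p := Real.logb_nonneg one_lt_two hp
  have h6 : 0 ≤ Real.logb 2 (T + 1) := Real.logb_nonneg one_lt_two (by linarith)
  rcases min_cases (s * Real.logb 2 p / ((1 - δ) * T) + s * Real.logb 2 (T + 1) / ((1 - δ) * T))
    (min (s * maxSqEntry D) 1) with ⟨he, -⟩ | ⟨he, -⟩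
  · rw [he]
    rcases le_or_gt 1 T with h1 | h1
    · exact minimaxRisk_le_of_one_le ha h1 hδ hD hA hU hL
    -- For `T < 1` the net is not needed: once `p ≥ 2` and `s ≥ 1`, the first rate term is at least
    -- one, so the trivial bound suffices. The cases `p = 1` and `s = 0` have zero risk.
    by_cases hp1 : p = 1
    · rw [hD.minimaxRisk_eq_zero_of_eq_one hp1]
      exact bot_le
    rcases Nat.eq_zero_or_pos s with hs | hs
    · subst hs
      simpa using htriv
    refine htriv.trans (ENNReal.ofReal_le_ofReal ((min_le_right _ _).trans ?_))
    have hp2 : (2 : ℝ) ≤ p := by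
      have := NeZero.ne p
      exact_mod_cast (by omega : 2 ≤ p)
    have h7 : 1 ≤ Real.logb 2 p := by
      rw [Real.le_logb_iff_rpow_le one_lt_two (by linarith)]
      simpa using hp2
    have hs1 : (1 : ℝ) ≤ s := by exact_mod_cast hs
    have h8 : 1 ≤ s * Real.logb 2 p / ((1 - δ) * T) := by
      rw [one_le_div (by positivity)]
      nlinarith
    have h9 : 0 ≤ s * Real.logb 2 (T + 1) / ((1 - δ) * T) := by positivity
    nlinarith
  · rw [he]
    exact htriv.trans (ENNReal.ofReal_le_ofReal (le_mul_of_one_le_left hm hC))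

end Risk

end PoissonInverse

theorem theorem2 (a_l a_u : ℝ) (ha : a_l < a_u) :
    (∃ C_U : ℝ, 0 < C_U ∧
      ∀ (n p : ℕ) [NeZero p] (s : ℕ) (T δ : ℝ) (D : Matrix (Fin p) (Fin p) ℝ)
        (A At : Matrix (Fin n) (Fin p) ℝ),
        0 < T → 0 ≤ δ → δ < 1 →
        PoissonInverse.IsBasisMatrix D →
        PoissonInverse.IsShiftedRescaled a_l a_u A At →
        PoissonInverse.UpperRIP s δ (At * D) →
        PoissonInverse.LowerRIP s δ (At * D) →
        PoissonInverse.minimaxRisk s T A D ≤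
          ENNReal.ofReal (C_U *
            min (s * Real.logb 2 p / ((1 - δ) * T) + s * Real.logb 2 (T + 1) / ((1 - δ) * T))
              (min (s * PoissonInverse.maxSqEntry D) 1))) ∧
    (∀ c : ℝ, 0 < c → ∃ C_U' : ℝ, 0 < C_U' ∧
      ∀ (n p : ℕ) [NeZero p] (s : ℕ) (T δ : ℝ) (D : Matrix (Fin p) (Fin p) ℝ)
        (A At : Matrix (Fin n) (Fin p) ℝ),
        0 < T → 0 ≤ δ → δ < 1 →
        PoissonInverse.IsBasisMatrix D →
        PoissonInverse.IsShiftedRescaled a_l a_u A At →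
        PoissonInverse.UpperRIP s δ (At * D) →
        PoissonInverse.LowerRIP s δ (At * D) →
        Real.logb 2 (T + 1) ≤ c * Real.logb 2 p →
        PoissonInverse.minimaxRisk s T A D ≤
          ENNReal.ofReal (C_U' *
            min (s * Real.logb 2 p / ((1 - δ) * T))
              (min (s * PoissonInverse.maxSqEntry D) 1))) := by
  refine ⟨⟨96 * (a_u - a_l) ^ 2 + 16, by positivity, ?_⟩, fun c hc ↦
    ⟨(96 * (a_u - a_l) ^ 2 + 16) * (1 + c), by positivity, ?_⟩⟩
  · intro n p _ s T δ D A At hT hδ0 hδ hD hA hU hL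
    exact PoissonInverse.minimaxRisk_le_rate ha hT hδ0 hδ hD hA hU hL
  · intro n p _ s T δ D A At hT hδ0 hδ hD hA hU hL hlog
    refine (PoissonInverse.minimaxRisk_le_rate ha hT hδ0 hδ hD hA hU hL).trans
      (ENNReal.ofReal_le_ofReal ?_)
    have hδ' : 0 < 1 - δ := sub_pos.2 hδ
    have hm : 0 ≤ min (s * PoissonInverse.maxSqEntry D) 1 :=
      le_min (mul_nonneg s.cast_nonneg (PoissonInverse.maxSqEntry_nonneg D)) zero_le_one
    -- The factor `1 + c` absorbs `log₂ (T + 1)` in the first term and only enlarges the others.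
    rw [mul_assoc, mul_min_of_nonneg _ _ (by positivity : 0 ≤ 1 + c)]
    refine mul_le_mul_of_nonneg_left (min_le_min ?_ ?_) (by positivity)
    · rw [← add_div, ← mul_div_assoc, ← mul_add]
      refine div_le_div_of_nonneg_right ?_ (by positivity)
      calc (s : ℝ) * (Real.logb 2 p + Real.logb 2 (T + 1))
          ≤ s * (Real.logb 2 p + c * Real.logb 2 p) := by gcongr
        _ = (1 + c) * (s * Real.logb 2 p) := by ring
    · exact le_mul_of_one_le_left hm (by linarith)
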